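/- Let $N,k,l\ge 0$ be integers, let $\theta>0$ and $a>-1$ be real, let $\kappa=(\kappa_1,\dots,\kappa_k)$ with $\kappa_i\in\mathbb C\setminus[0,\infty)$ and $\lambda=(\lambda_1,\dots,\lambda_l)\in\mathbb C^l$. Define the generalised partition function of the $\theta$-deformed Bures ensemble $$Z^{(N,a,B)}_{k|l}(\kappa,\lambda)=\frac1{N!}\int_{\mathbb R_+^N}\prod_{1\le i<j\le N}\frac{x_j-x_i}{x_j+x_i}\,(x_j^\theta-x_i^\theta)\;\prod_{j=1}^N\frac{\prod_{i=1}^l(x_j^\theta-\lambda_i)}{\prod_{i=1}^k(x_j-\kappa_i)}\,x_j^a e^{-x_j}\,dx_j$$ and, for real $b>-1$, the generalised partition function of the $\theta$-deformed Cauchy two-matrix model $$Z^{(N,a,b,C)}_{k_1|l_1;k_2|l_2}(\kappa_1,\lambda_1;\kappa_2,\lambda_2)=\frac1{(N!)^2}\int_{\mathbb R_+^N\times\mathbb R_+^N}\frac{\prod_{1\le i<j\le N}(x_j-x_i)(y_j-y_i)}{\prod_{i,j=1}^N(x_i+y_j)}\prod_{1\le i<j\le N}(x_j^\theta-x_i^\theta)(y_j^\theta-y_i^\theta)$$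 $$\times\prod_{j=1}^N x_j^ae^{-x_j}\,y_j^be^{-y_j}\,\frac{\prod_{i=1}^{l_1}(x_j^\theta-\lambda_{1,i})\prod_{i=1}^{l_2}(y_j^\theta-\lambda_{2,i})}{\prod_{i=1}^{k_1}(x_j-\kappa_{1,i})\prod_{i=1}^{k_2}(y_j-\kappa_{2,i})}\,dx_j\,dy_j .$$ Then the integrals defining $Z^{(N,a,B)}_{k|l}(\kappa,\lambda)$ and $Z^{(N,a,a+1,C)}_{k|l;k|l}(\kappa,\lambda;\kappa,\lambda)$ converge absolutely, and $$\bigl(Z^{(N,a,B)}_{k|l}(\kappa,\lambda)\bigr)^2=2^N\,Z^{(N,a,a+1,C)}_{k|l;k|l}(\kappa,\lambda;\kappa,\lambda).$$ -/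

import Mathlib

open MeasureTheory

namespace ThetaBures

/-- The open positive orthant `ℝ₊ᴺ`. -/
def orthant (N : ℕ) : Set (Fin N → ℝ) :=
  Set.univ.pi fun _ => Set.Ioi 0

/-- The Vandermonde product `∏_{i < j} (z_j - z_i)`. -/
noncomputable def vandermondeProd {N : ℕ} (z : Fin N → ℝ) : ℝ :=
  ∏ i, ∏ j ∈ Finset.Ioi i, (z j - z i)

/-- The Laguerre weight `x ^ a * e ^ (-x)` times the ratio of characteristic factors
`∏ᵢ (x ^ θ - lam i) / ∏ᵢ (x - κ i)`. -/
noncomputable def charWeight {k l : ℕ} (θ a : ℝ) (κ : Fin k → ℂ) (lam : Fin l → ℂ) (x : ℝ) : ℂ :=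
  ((x ^ a * Real.exp (-x) : ℝ) : ℂ) *
    ((∏ i, (((x ^ θ : ℝ) : ℂ) - lam i)) / ∏ i, ((x : ℂ) - κ i))

/-- Integrand of the generalised partition function of the `θ`-deformed Bures ensemble. -/
noncomputable def buresIntegrand {N k l : ℕ} (θ a : ℝ) (κ : Fin k → ℂ) (lam : Fin l → ℂ)
    (x : Fin N → ℝ) : ℂ :=
  ((∏ i, ∏ j ∈ Finset.Ioi i, ((x j - x i) / (x j + x i) * (x j ^ θ - x i ^ θ)) : ℝ) : ℂ) *
    ∏ j, charWeight θ a κ lam (x j)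

/-- Generalised partition function of the `θ`-deformed Bures ensemble. -/
noncomputable def buresZ (N : ℕ) {k l : ℕ} (θ a : ℝ) (κ : Fin k → ℂ) (lam : Fin l → ℂ) : ℂ :=
  (1 / (N.factorial : ℂ)) * ∫ x in orthant N, buresIntegrand θ a κ lam x

/-- Integrand of the generalised partition function of the `θ`-deformed Cauchy two-matrix model. -/
noncomputable def cauchyIntegrand {N k₁ l₁ k₂ l₂ : ℕ} (θ a b : ℝ)
    (κ₁ : Fin k₁ → ℂ) (lam₁ : Fin l₁ → ℂ) (κ₂ : Fin k₂ → ℂ) (lam₂ : Fin l₂ → ℂ)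
    (p : (Fin N → ℝ) × (Fin N → ℝ)) : ℂ :=
  ((vandermondeProd p.1 * vandermondeProd p.2 / (∏ i, ∏ j, (p.1 i + p.2 j)) *
      (vandermondeProd (fun i => p.1 i ^ θ) * vandermondeProd (fun i => p.2 i ^ θ)) : ℝ) : ℂ) *
    ∏ j, (charWeight θ a κ₁ lam₁ (p.1 j) * charWeight θ b κ₂ lam₂ (p.2 j))

/-- Generalised partition function of the `θ`-deformed Cauchy two-matrix model. -/
noncomputable def cauchyZ (N : ℕ) {k₁ l₁ k₂ l₂ : ℕ} (θ a b : ℝ)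
    (κ₁ : Fin k₁ → ℂ) (lam₁ : Fin l₁ → ℂ) (κ₂ : Fin k₂ → ℂ) (lam₂ : Fin l₂ → ℂ) : ℂ :=
  (1 / (N.factorial : ℂ) ^ 2) *
    ∫ p in orthant N ×ˢ orthant N, cauchyIntegrand θ a b κ₁ lam₁ κ₂ lam₂ p

end ThetaBures

/-! Both sides reduce to one determinant, through the kernel identity `2 y / (x + y) = (y - x) / (y
+ x) + 1`.

Bures side: expanding the Vandermonde in `x ^ θ` cancels `1 / N!` and leaves `buresForm`, an
alternating form in the functions `x ^ (θ j)` times the weight, with kernel `∏ (x_j - x_i) / (x_j +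
x_i)`. By Schur's Pfaffian identity this kernel obeys Pfaffian expansions (`schurProd_even`, and
`schurProd_odd` for the matrix bordered by ones). Fubini passes them to `buresForm`, with the skew
form `ω = skewForm` and the border `u = integralForm`. Any such family satisfies `F ^ 2 = det (ω + u
⊗ u)` in both parities (`sq_eq_det_addRankOne`).

Cauchy side: the extra factor `y` coming from `b = a + 1` turns the Cauchy determinant into `det
(y_j / (x_i + y_j))`. Expanding both Vandermondes and applying Andréief's identity gives the
determinant of `cauchyPairing` (`cauchyZ_eq_det`). By the kernel identity the Gram matrix of `ω + u
⊗ u` is twice this one, whence `2 ^ N`.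

Convergence is domination: both kernels are bounded by 1 on the positive axis, so one-variable
integrability suffices. -/

namespace ThetaBures

/-! ### Pfaffian expansions and squares of alternating maps. -/

section Pfaffian

variable {K V : Type*} [Field K] [AddCommGroup V] [Module K V]

/-- The matrix of values of a bilinear form on a finite family of vectors. -/
def bilinGram {n : ℕ} (β : V →ₗ[K] V →ₗ[K] K) (v : Fin n → V) : Matrix (Fin n) (Fin n) K :=
  Matrix.of fun i j => β (v i) (v j)

/-- Pulled back along coordinates, `F` becomes an alternating form of top degree on `K ^ n`, hence a
multiple of the determinant. -/
theorem alternatingMap_sum_smul {n : ℕ} (F : V [⋀^Fin n]→ₗ[K] K) (v : Fin n → V)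
    (B : Matrix (Fin n) (Fin n) K) :
    F (fun i => ∑ j, B i j • v j) = B.det * F v := by
  let r : Fin n → Fin n → K := fun i j => B i j
  have h := DFunLike.congr_fun
    ((F.compLinearMap (Fintype.linearCombination K v)).eq_smul_basis_det (Pi.basisFun K (Fin n))) r
  rw [AlternatingMap.smul_apply, Pi.basisFun_det_apply, AlternatingMap.compLinearMap_apply,
    AlternatingMap.compLinearMap_apply, smul_eq_mul, mul_comm] at h
  simp only [Fintype.linearCombination_apply, Pi.basisFun_apply, Pi.single_apply, ite_smul,
    one_smul, zero_smul, Finset.sum_ite_eq', Finset.mem_univ, if_true] at h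
  exact h

theorem bilinGram_sum_smul {n : ℕ} (β : V →ₗ[K] V →ₗ[K] K) (v : Fin n → V)
    (B : Matrix (Fin n) (Fin n) K) :
    bilinGram β (fun i => ∑ j, B i j • v j) = B * bilinGram β v * B.transpose := by
  ext i j
  simp only [bilinGram, Matrix.of_apply, map_sum, LinearMap.sum_apply, map_smul,
    LinearMap.smul_apply, smul_eq_mul, Matrix.mul_apply, Matrix.transpose_apply,
    Finset.sum_mul, Finset.mul_sum]
  refine Finset.sum_congr rfl fun _ _ => Finset.sum_congr rfl fun _ _ => ?_
  ring

/-- The elementary matrix adding `c i` times row `k` to row `i`. -/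
def shearMatrix {n : ℕ} (c : Fin n → K) (k : Fin n) : Matrix (Fin n) (Fin n) K :=
  Matrix.of fun i j => (1 : Matrix (Fin n) (Fin n) K) i j + c i * (1 : Matrix _ _ K) k j

theorem det_shearMatrix {n : ℕ} (c : Fin n → K) (k : Fin n) (hc : c k = 0) :
    (shearMatrix c k).det = 1 := by
  rw [Matrix.det_eq_of_forall_row_eq_smul_add_const (A := shearMatrix c k) (B := 1) c k hc
    (fun i j => rfl), Matrix.det_one]

theorem sum_shearMatrix_smul {n : ℕ} (c : Fin n → K) (k : Fin n) (v : Fin n → V) :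
    (fun i => ∑ j, shearMatrix c k i j • v j) = fun i => v i + c i • v k := by
  ext i
  simp [shearMatrix, add_smul, Finset.sum_add_distrib, Matrix.one_apply]

theorem alternatingMap_shear {n : ℕ} (F : V [⋀^Fin n]→ₗ[K] K) (v : Fin n → V)
    (c : Fin n → K) (k : Fin n) (hc : c k = 0) : F (fun i => v i + c i • v k) = F v := by
  rw [← sum_shearMatrix_smul, alternatingMap_sum_smul, det_shearMatrix c k hc, one_mul]

theorem det_bilinGram_shear {n : ℕ} (β : V →ₗ[K] V →ₗ[K] K) (v : Fin n → V)
    (c : Fin n → K) (k : Fin n) (hc : c k = 0) :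
    (bilinGram β (fun i => v i + c i • v k)).det = (bilinGram β v).det := by
  rw [← sum_shearMatrix_smul, bilinGram_sum_smul, Matrix.det_mul, Matrix.det_mul,
    Matrix.det_transpose, det_shearMatrix c k hc, one_mul, mul_one]

theorem alternatingMap_comp_perm_sq {n : ℕ} (F : V [⋀^Fin n]→ₗ[K] K) (v : Fin n → V)
    (σ : Equiv.Perm (Fin n)) : F (v ∘ σ) ^ 2 = F v ^ 2 := by
  rw [AlternatingMap.map_perm]
  rcases Int.units_eq_one_or (Equiv.Perm.sign σ) with h | h <;> simp [h]

theorem det_bilinGram_comp_perm {n : ℕ} (β : V →ₗ[K] V →ₗ[K] K) (v : Fin n → V)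
    (σ : Equiv.Perm (Fin n)) : (bilinGram β (v ∘ σ)).det = (bilinGram β v).det :=
  Matrix.det_submatrix_equiv_self σ (bilinGram β v)

/-- If the first vector pairs to zero with all but the second one, the determinant of the Gram
matrix of an alternating form loses its first two rows and columns. -/
theorem det_bilinGram_of_pivot {n : ℕ} {ω : V →ₗ[K] V →ₗ[K] K} (hω : ω.IsAlt)
    (v : Fin (n + 2) → V) (hv : ∀ j : Fin n, ω (v 0) (v j.succ.succ) = 0) :
    (bilinGram ω v).det =
      ω (v 0) (v 1) ^ 2 * (bilinGram ω (fun i : Fin n => v i.succ.succ)).det := by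
  have hsw : ∀ x y, ω x y = - ω y x := fun x y => (hω.neg y x).symm
  have hv' : ∀ j : Fin n, ω (v j.succ.succ) (v 0) = 0 := fun j => by rw [hsw, hv, neg_zero]
  rw [Matrix.det_succ_row_zero, Fin.sum_univ_succ, Fin.sum_univ_succ,
    Finset.sum_eq_zero (fun j _ => by simp [bilinGram, hv]),
    Matrix.det_succ_column_zero (Matrix.submatrix _ _ (Fin.succAbove (Fin.succ 0))),
    Fin.sum_univ_succ, Finset.sum_eq_zero (fun j _ => by simp [bilinGram, hv'])]
  have h0 : ω (v 0) (v 0) = 0 := hω (v 0)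
  have hsub : ((bilinGram ω v).submatrix Fin.succ (Fin.succAbove (Fin.succ 0))).submatrix
      (Fin.succAbove 0) Fin.succ = bilinGram ω (fun i : Fin n => v i.succ.succ) := by
    ext i j
    simp [bilinGram]
  rw [hsub]
  simp [bilinGram, h0, hsw (v 1) (v 0)]
  ring

/-- A family of alternating maps obeying the expansion rule of the Pfaffian of an alternating
form squares to the determinant of the form. -/
theorem sq_eq_det_of_pfaffian_expansion {ω : V →ₗ[K] V →ₗ[K] K} (hω : ω.IsAlt)
    (F : ∀ n, V [⋀^Fin n]→ₗ[K] K) (h0 : ∀ v, F 0 v = 1)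
    (hF : ∀ n, Even n → ∀ v : Fin (n + 2) → V, F (n + 2) v =
      ∑ j : Fin (n + 1), (-1) ^ (j : ℕ) * ω (v 0) (v j.succ) *
        F n (fun i => v (j.succAbove i).succ)) :
    ∀ n, Even n → ∀ v : Fin n → V, F n v ^ 2 = (bilinGram ω v).det := by
  intro n
  induction n using Nat.strong_induction_on with
  | _ n ih =>
  intro hn v
  match n, hn with
  | 0, _ => simp [h0]
  | 1, hn => exact absurd hn (by decide)
  | n + 2, hn =>
    have hn' : Even n := by
      rcases hn with ⟨m, hm⟩
      exact ⟨m - 1, by omega⟩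
    -- If the first vector is orthogonal to all others, both sides vanish. Otherwise a permutation
    -- and a shear, neither of which changes either side, bring the family to the pivot form, where
    -- the expansion has a single term.
    by_cases hz : ∀ j : Fin (n + 1), ω (v 0) (v j.succ) = 0
    · rw [hF n hn', Finset.sum_eq_zero (fun j _ => by simp [hz j]),
        Matrix.det_eq_zero_of_row_eq_zero (0 : Fin (n + 2))]
      · simp
      · refine Fin.cases ?_ fun j => ?_
        · exact hω (v 0)
        · exact hz j
    · push Not at hz
      obtain ⟨j, hj⟩ := hz
      set σ : Equiv.Perm (Fin (n + 2)) := Equiv.swap 1 j.succ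
      have hσ0 : σ 0 = 0 := Equiv.swap_apply_of_ne_of_ne (by simp) (Fin.succ_ne_zero j).symm
      have hσ1 : σ 1 = j.succ := Equiv.swap_apply_left _ _
      set w := v ∘ σ with hw
      have hw01 : ω (w 0) (w 1) ≠ 0 := by simpa [hw, hσ0, hσ1] using hj
      rw [← alternatingMap_comp_perm_sq _ _ σ, ← det_bilinGram_comp_perm _ _ σ, ← hw]
      -- Gaussian elimination with pivot `ω (w 0) (w 1)`; the first two vectors stay as they are.
      set c : Fin (n + 2) → K := Fin.cons 0 (Fin.cons 0 fun i : Fin n =>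
        - (ω (w 0) (w i.succ.succ) / ω (w 0) (w 1))) with hc
      have hc0 : c 0 = 0 := rfl
      have hc1 : c 1 = 0 := rfl
      have hcs : ∀ i : Fin n, c i.succ.succ = - (ω (w 0) (w i.succ.succ) / ω (w 0) (w 1)) :=
        fun i => rfl
      rw [← alternatingMap_shear _ w c 1 hc1, ← det_bilinGram_shear _ w c 1 hc1]
      set z : Fin (n + 2) → V := fun i => w i + c i • w 1 with hzdef
      have hz0 : z 0 = w 0 := by simp [hzdef, hc0]
      have hzz : ∀ i : Fin n, ω (z 0) (z i.succ.succ) = 0 := by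
        intro i
        rw [hz0]
        simp only [hzdef, hcs, map_add, map_smul, smul_eq_mul]
        field_simp
        ring
      rw [det_bilinGram_of_pivot hω z hzz, ← ih n (by omega) hn', hF n hn', Fin.sum_univ_succ,
        Finset.sum_eq_zero (fun j _ => by simp [hzz j])]
      simp [mul_pow]

theorem det_bilinGram_odd [CharZero K] {ω : V →ₗ[K] V →ₗ[K] K} (hω : ω.IsAlt) {n : ℕ}
    (hn : Odd n) (v : Fin n → V) : (bilinGram ω v).det = 0 := by
  have h : (bilinGram ω v).transpose = -bilinGram ω v := by
    ext i j
    exact (hω.neg (v i) (v j)).symm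
  have h2 := Matrix.det_transpose (bilinGram ω v)
  rw [h, Matrix.det_neg, Fintype.card_fin, hn.neg_one_pow] at h2
  have h3 : 2 * (bilinGram ω v).det = 0 := by linear_combination -h2
  simpa using h3

/-- The bilinear form `(x, y) ↦ ω x y + u x * u y`. -/
def addRankOne (ω : V →ₗ[K] V →ₗ[K] K) (u : V →ₗ[K] K) : V →ₗ[K] V →ₗ[K] K :=
  ω + (LinearMap.mul K K).compl₁₂ u u

@[simp]
theorem addRankOne_apply (ω : V →ₗ[K] V →ₗ[K] K) (u : V →ₗ[K] K) (x y : V) :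
    addRankOne ω u x y = ω x y + u x * u y := rfl

/-- The rank-one term alters only the corner entry of the Gram matrix, and the determinant is affine
in that entry. -/
theorem det_bilinGram_addRankOne {ω : V →ₗ[K] V →ₗ[K] K} {u : V →ₗ[K] K} {n : ℕ}
    (v : Fin (n + 1) → V) (hv : ∀ i : Fin n, u (v i.succ) = 0) :
    (bilinGram (addRankOne ω u) v).det =
      (bilinGram ω v).det + u (v 0) ^ 2 * (bilinGram ω fun i : Fin n => v i.succ).det := by
  have hsub : ∀ j : Fin (n + 1), (bilinGram (addRankOne ω u) v).submatrix Fin.succ j.succAbove =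
      (bilinGram ω v).submatrix Fin.succ j.succAbove := by
    intro j
    ext i k
    simp [bilinGram, hv]
  have hsub0 : (bilinGram ω v).submatrix Fin.succ (Fin.succAbove 0) =
      bilinGram ω fun i : Fin n => v i.succ := by
    ext i k
    simp [bilinGram]
  rw [Matrix.det_succ_row_zero, Matrix.det_succ_row_zero (bilinGram ω v), Fin.sum_univ_succ,
    Fin.sum_univ_succ]
  simp only [hsub, hsub0]
  simp [bilinGram, hv]
  ring

/-- A family of alternating maps obeying the expansion rules of the Pfaffian of an alternating
form `ω` in even degree, and of `ω` bordered by a linear form `u` in odd degree, squares to the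
determinant of `ω + u ⊗ u`. -/
theorem sq_eq_det_addRankOne [CharZero K] {ω : V →ₗ[K] V →ₗ[K] K} (hω : ω.IsAlt)
    (u : V →ₗ[K] K) (F : ∀ n, V [⋀^Fin n]→ₗ[K] K) (h0 : ∀ v, F 0 v = 1)
    (heven : ∀ n, Even n → ∀ v : Fin (n + 2) → V, F (n + 2) v =
      ∑ j : Fin (n + 1), (-1) ^ (j : ℕ) * ω (v 0) (v j.succ) *
        F n (fun i => v (j.succAbove i).succ))
    (hodd : ∀ n, Even n → ∀ v : Fin (n + 1) → V, F (n + 1) v =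
      ∑ j : Fin (n + 1), (-1) ^ (j : ℕ) * u (v j) * F n (fun i => v (j.succAbove i)))
    (n : ℕ) (v : Fin n → V) : F n v ^ 2 = (bilinGram (addRankOne ω u) v).det := by
  have hpf := sq_eq_det_of_pfaffian_expansion hω F h0 heven
  match n with
  | 0 => simp [h0]
  | n + 1 =>
    by_cases hz : ∀ j : Fin (n + 1), u (v j) = 0
    · have hG : bilinGram (addRankOne ω u) v = bilinGram ω v := by
        ext i j
        simp [bilinGram, hz]
      rw [hG]
      rcases Nat.even_or_odd n with hn | hn
      · rw [det_bilinGram_odd hω hn.add_one, hodd n hn,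
          Finset.sum_eq_zero (fun j _ => by simp [hz j])]
        simp
      · exact hpf _ hn.add_one v
    · push Not at hz
      obtain ⟨j, hj⟩ := hz
      set σ : Equiv.Perm (Fin (n + 1)) := Equiv.swap 0 j
      have hσ0 : σ 0 = j := Equiv.swap_apply_left _ _
      set w := v ∘ σ with hw
      have hw0 : u (w 0) ≠ 0 := by simpa [hw, hσ0] using hj
      rw [← alternatingMap_comp_perm_sq _ _ σ, ← det_bilinGram_comp_perm _ _ σ, ← hw]
      -- This shear makes `u` vanish on every vector but the first.
      set c : Fin (n + 1) → K := Fin.cons 0 fun i : Fin n => - (u (w i.succ) / u (w 0)) with hc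
      have hc0 : c 0 = 0 := rfl
      have hcs : ∀ i : Fin n, c i.succ = - (u (w i.succ) / u (w 0)) := fun i => rfl
      rw [← alternatingMap_shear _ w c 0 hc0, ← det_bilinGram_shear _ w c 0 hc0]
      set z : Fin (n + 1) → V := fun i => w i + c i • w 0 with hzdef
      have hzs : ∀ i : Fin n, u (z i.succ) = 0 := by
        intro i
        simp only [hzdef, hcs, map_add, map_smul, smul_eq_mul]
        field_simp
        ring
      rw [det_bilinGram_addRankOne z hzs]
      -- Of the two Gram determinants, of sizes `n + 1` and `n`, the one of odd size vanishes; the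
      -- other is the square of a Pfaffian.
      rcases Nat.even_or_odd n with hn | hn
      · rw [det_bilinGram_odd hω hn.add_one, hodd n hn, Fin.sum_univ_succ,
          Finset.sum_eq_zero (fun j _ => by simp [hzs j]), ← hpf n hn]
        simp [mul_pow]
      · rw [hpf _ hn.add_one, det_bilinGram_odd hω hn]
        simp

end Pfaffian

/-! ### Schur's Pfaffian identity, as expansion rules. -/

/-- The kernel `(b - a) / (b + a)`. -/
noncomputable def schurKernel (a b : ℝ) : ℝ := (b - a) / (b + a)

/-- The product `∏_{i < j} (x_j - x_i) / (x_j + x_i)`. -/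
noncomputable def schurProd {n : ℕ} (x : Fin n → ℝ) : ℝ :=
  ∏ i, ∏ j ∈ Finset.Ioi i, schurKernel (x i) (x j)

theorem schurKernel_swap (a b : ℝ) : schurKernel a b = -schurKernel b a := by
  rw [schurKernel, schurKernel, ← neg_div, neg_sub, add_comm]

theorem abs_schurKernel_le {a b : ℝ} (ha : 0 < a) (hb : 0 < b) : |schurKernel a b| ≤ 1 := by
  rw [schurKernel, abs_div, abs_of_pos (add_pos hb ha), div_le_one (add_pos hb ha), abs_le]
  constructor <;> linarith

theorem schurKernel_ne_zero {a b : ℝ} (ha : 0 < a) (hb : 0 < b) (h : a ≠ b) :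
    schurKernel a b ≠ 0 :=
  div_ne_zero (sub_ne_zero.2 h.symm) (add_pos hb ha).ne'

theorem abs_schurProd_le {n : ℕ} {x : Fin n → ℝ} (hx : ∀ i, 0 < x i) : |schurProd x| ≤ 1 := by
  rw [schurProd, Finset.abs_prod]
  refine Finset.prod_le_one (fun _ _ => abs_nonneg _) fun i _ => ?_
  rw [Finset.abs_prod]
  exact Finset.prod_le_one (fun _ _ => abs_nonneg _) fun j _ => abs_schurKernel_le (hx i) (hx j)

theorem schurProd_comp_perm {n : ℕ} (x : Fin n → ℝ) (σ : Equiv.Perm (Fin n)) :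
    schurProd (x ∘ σ) = (Equiv.Perm.sign σ : ℤ) * schurProd x :=
  σ.prod_Ioi_comp_eq_sign_mul_prod (f := fun i j => schurKernel (x i) (x j))
    fun _ _ => schurKernel_swap _ _

theorem schurProd_succ {n : ℕ} (x : Fin (n + 1) → ℝ) :
    schurProd x = (∏ i : Fin n, schurKernel (x 0) (x i.succ)) * schurProd (fun i => x i.succ) := by
  simp only [schurProd, Fin.prod_univ_succ (n := n), Fin.prod_Ioi_zero, Fin.prod_Ioi_succ]

/-- The cycle moving index `j` to the front has sign `(-1) ^ j`. -/
theorem schurProd_succAbove {n : ℕ} (x : Fin (n + 1) → ℝ) (j : Fin (n + 1)) :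
    schurProd x = (-1) ^ (j : ℕ) * ((∏ i : Fin n, schurKernel (x j) (x (j.succAbove i))) *
      schurProd (fun i => x (j.succAbove i))) := by
  have h := schurProd_comp_perm x j.cycleRange.symm
  rw [schurProd_succ] at h
  simp only [Function.comp_apply, Fin.cycleRange_symm_zero, Fin.cycleRange_symm_succ,
    Equiv.Perm.sign_symm, Fin.sign_cycleRange] at h
  rw [h, ← mul_assoc]
  push_cast
  rw [← mul_pow]
  simp

/-- Partial fraction expansion of `1 + ∏ (y_m - t) / (y_m + t)`. -/
theorem one_add_prod_schurKernel {n : ℕ} (hn : Even n) {y : Fin (n + 1) → ℝ}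
    (hy : ∀ i, 0 < y i) (hinj : Function.Injective y) {t : ℝ} (ht : 0 ≤ t) :
    1 + ∏ i, schurKernel t (y i) =
      ∑ j, (∏ i, schurKernel (y j) (y (j.succAbove i)))⁻¹ * (1 + schurKernel t (y j)) := by
  open Polynomial in
  -- The leading terms cancel, so Lagrange interpolation at the `n + 1` nodes `-y i` recovers `D`.
  -- At a node the first product vanishes, which gives the closed form in `hnode`.
  set D : ℝ[X] := ∏ i, (X - C (-y i)) - ∏ i, (X - C (y i)) with hD
  have hdeg : D.degree < (Finset.univ : Finset (Fin (n + 1))).card := by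
    have h1 : (∏ i, (Polynomial.X - Polynomial.C (-y i))).degree = ((n + 1 : ℕ) : WithBot ℕ) := by
      rw [Polynomial.degree_prod]; simp
    have h2 : (∏ i, (Polynomial.X - Polynomial.C (y i))).degree = ((n + 1 : ℕ) : WithBot ℕ) := by
      rw [Polynomial.degree_prod]; simp
    rw [Finset.card_univ, Fintype.card_fin, ← h1]
    refine Polynomial.degree_sub_lt_left (h1.trans h2.symm) ?_ ?_
    · exact (Polynomial.monic_prod_X_sub_C _ _).ne_zero
    · rw [(Polynomial.monic_prod_X_sub_C _ _).leadingCoeff,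
        (Polynomial.monic_prod_X_sub_C _ _).leadingCoeff]
  have hinj' : Set.InjOn (fun i => -y i) (Finset.univ : Finset (Fin (n + 1))) :=
    fun i _ j _ h => hinj (neg_injective h)
  have hev := congrArg (Polynomial.eval t) (Lagrange.eq_interpolate hinj' hdeg)
  have hpos : ∀ i, y i + t ≠ 0 := fun i => by have := hy i; positivity
  have hDt : D.eval t = (∏ i, (y i + t)) * (1 + ∏ i, schurKernel t (y i)) := by
    -- The number of factors, `n + 1`, is odd; this is where parity enters.
    have h1 : ∏ i, (t - y i) = - ∏ i, (y i - t) := by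
      have : ∀ i, t - y i = -1 * (y i - t) := fun i => by ring
      simp_rw [this]
      rw [Finset.prod_mul_distrib, Finset.prod_const, Finset.card_univ, Fintype.card_fin,
        hn.add_one.neg_one_pow]
      ring
    simp only [hD, Polynomial.eval_sub, Polynomial.eval_prod, Polynomial.eval_X,
      Polynomial.eval_C, schurKernel, Finset.prod_div_distrib, h1]
    rw [mul_add, mul_div_cancel₀ _ (Finset.prod_ne_zero_iff.2 fun i _ => hpos i)]
    simp [add_comm]
  have hnode : ∀ j, D.eval (-y j) = 2 * y j * ∏ i, (y (j.succAbove i) + y j) := by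
    intro j
    have h1 : ∏ i, (-y j - y i) = - ∏ i, (y i + y j) := by
      have : ∀ i, -y j - y i = -1 * (y i + y j) := fun i => by ring
      simp_rw [this]
      rw [Finset.prod_mul_distrib, Finset.prod_const, Finset.card_univ, Fintype.card_fin,
        hn.add_one.neg_one_pow]
      ring
    simp only [hD, Polynomial.eval_sub, Polynomial.eval_prod, Polynomial.eval_X,
      Polynomial.eval_C, h1]
    rw [Finset.prod_eq_zero (Finset.mem_univ j) (by ring), Fin.prod_univ_succAbove _ j]
    ring
  have hbasis : ∀ j, (Lagrange.basis Finset.univ (fun i => -y i) j).eval t =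
      ∏ i, ((y (j.succAbove i) + t) / (y (j.succAbove i) - y j)) := by
    intro j
    have : (Finset.univ : Finset (Fin (n + 1))).erase j =
        Finset.univ.map j.succAboveEmb := by
      ext i
      simp [Fin.exists_succAbove_eq_iff]
    rw [Lagrange.basis, this, Finset.prod_map, Polynomial.eval_prod]
    refine Finset.prod_congr rfl fun i _ => ?_
    simp only [Lagrange.basisDivisor, Polynomial.eval_mul, Polynomial.eval_C,
      Polynomial.eval_sub, Polynomial.eval_X]
    simp
    rw [div_eq_inv_mul]
    congr 1 <;> ring
  rw [Lagrange.interpolate_apply, Polynomial.eval_finsetSum, hDt] at hev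
  refine mul_left_cancel₀ (Finset.prod_ne_zero_iff.2 fun i _ => hpos i) (hev.trans ?_)
  rw [Finset.mul_sum]
  refine Finset.sum_congr rfl fun j _ => ?_
  have hj : (1 + schurKernel t (y j)) = 2 * y j / (y j + t) := by
    have := hpos j
    rw [schurKernel]
    field_simp
    ring
  rw [Polynomial.eval_mul, Polynomial.eval_C, hnode, hbasis, hj, Fin.prod_univ_succAbove _ j]
  simp only [schurKernel, Finset.prod_div_distrib, inv_div]
  have := hpos j
  field_simp

/-- The partial fraction expansion at `t = 0`, where every kernel equals 1. -/
theorem sum_inv_prod_schurKernel {n : ℕ} (hn : Even n) {y : Fin (n + 1) → ℝ}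
    (hy : ∀ i, 0 < y i) (hinj : Function.Injective y) :
    ∑ j, (∏ i, schurKernel (y j) (y (j.succAbove i)))⁻¹ = 1 := by
  have h := one_add_prod_schurKernel hn hy hinj le_rfl
  have h1 : ∀ i, schurKernel 0 (y i) = 1 := fun i => by simp [schurKernel, (hy i).ne']
  simp only [h1, Finset.prod_const_one, ← Finset.sum_mul] at h
  linarith

theorem schurProd_erase {n : ℕ} {y : Fin (n + 1) → ℝ} (hy : ∀ i, 0 < y i)
    (hinj : Function.Injective y) (j : Fin (n + 1)) :
    (-1) ^ (j : ℕ) * schurProd (fun i => y (j.succAbove i)) =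
      (∏ i, schurKernel (y j) (y (j.succAbove i)))⁻¹ * schurProd y := by
  have h0 : ∏ i, schurKernel (y j) (y (j.succAbove i)) ≠ 0 :=
    Finset.prod_ne_zero_iff.2 fun i _ => schurKernel_ne_zero (hy _) (hy _)
      (hinj.ne (Fin.succAbove_ne j i).symm)
  rw [schurProd_succAbove y j]
  field_simp

/-- Expansion of the Schur product in an odd number of variables. -/
theorem schurProd_odd {n : ℕ} (hn : Even n) {y : Fin (n + 1) → ℝ}
    (hy : ∀ i, 0 < y i) (hinj : Function.Injective y) :
    schurProd y = ∑ j : Fin (n + 1), (-1) ^ (j : ℕ) * schurProd (fun i => y (j.succAbove i)) := by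
  simp_rw [schurProd_erase hy hinj]
  rw [← Finset.sum_mul, sum_inv_prod_schurKernel hn hy hinj, one_mul]

/-- Expansion of the Schur product in an even number of variables along the first one. -/
theorem schurProd_even {n : ℕ} (hn : Even n) {x : Fin (n + 2) → ℝ}
    (hx : ∀ i, 0 < x i) (hinj : Function.Injective x) :
    schurProd x = ∑ j : Fin (n + 1), (-1) ^ (j : ℕ) * schurKernel (x 0) (x j.succ) *
      schurProd (fun i => x (j.succAbove i).succ) := by
  have hy : ∀ i : Fin (n + 1), 0 < x i.succ := fun i => hx _
  have hyi : Function.Injective fun i : Fin (n + 1) => x i.succ :=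
    hinj.comp (Fin.succ_injective _)
  have h := one_add_prod_schurKernel hn hy hyi (hx 0).le
  -- With `t = x 0`, the residues sum to 1 and cancel the constant term on the left.
  simp only [mul_add, mul_one, Finset.sum_add_distrib, sum_inv_prod_schurKernel hn hy hyi] at h
  rw [schurProd_succ, add_left_cancel h, Finset.sum_mul]
  refine Finset.sum_congr rfl fun j _ => ?_
  have := schurProd_erase hy hyi j
  rw [mul_right_comm, ← this]
  ring

/-! ### The Cauchy determinant by row elimination. -/

/-- The **Cauchy determinant**. -/
theorem det_cauchy {n : ℕ} (x y : Fin n → ℝ) (h : ∀ i j, x i + y j ≠ 0) :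
    (Matrix.of fun i j => (x i + y j)⁻¹).det =
      vandermondeProd x * vandermondeProd y / ∏ i, ∏ j, (x i + y j) := by
  induction n with
  | zero => simp [vandermondeProd]
  | succ n ih =>
    set A : Matrix (Fin (n + 1)) (Fin (n + 1)) ℝ := Matrix.of fun i j => (x i + y j)⁻¹ with hA
    -- These multipliers clear column zero below the corner. The remaining entries are again Cauchy,
    -- up to a row factor and a column factor (`hsub`).
    set c : Fin (n + 1) → ℝ := Fin.cons 0 fun i => (x 0 + y 0) / (x i.succ + y 0) with hc
    set B : Matrix (Fin (n + 1)) (Fin (n + 1)) ℝ := Matrix.of fun i j => A i j - c i * A 0 j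
      with hB
    have hc0 : c 0 = 0 := rfl
    have hcs : ∀ i : Fin n, c i.succ = (x 0 + y 0) / (x i.succ + y 0) := fun i => rfl
    have hAB : A.det = B.det := by
      refine Matrix.det_eq_of_forall_row_eq_smul_add_const c 0 hc0 fun i j => ?_
      simp [hB, hc0]
    have hB0 : ∀ i : Fin n, B i.succ 0 = 0 := by
      intro i
      have h1 := h i.succ 0
      have h2 := h 0 0
      simp only [hB, hA, hcs, Matrix.of_apply]
      field_simp
      ring
    have hsub : (B.submatrix Fin.succ Fin.succ).det =
        (∏ i : Fin n, (x i.succ - x 0) / (x i.succ + y 0)) *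
        ((∏ j : Fin n, (y j.succ - y 0) / (x 0 + y j.succ)) *
          (Matrix.of fun i j : Fin n => (x i.succ + y j.succ)⁻¹).det) := by
      rw [← Matrix.det_mul_row, ← Matrix.det_mul_column]
      congr 1
      ext i j
      have h1 := h i.succ j.succ
      have h2 := h 0 j.succ
      have h3 := h i.succ 0
      have h4 := h 0 0
      simp only [hB, hA, hcs, Matrix.of_apply, Matrix.submatrix_apply]
      field_simp
      ring
    rw [hAB, Matrix.det_succ_column_zero, Fin.sum_univ_succ,
      Finset.sum_eq_zero (fun i _ => by rw [hB0]; ring)]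
    have hs0 : (Fin.succAbove (0 : Fin (n + 1))) = Fin.succ := by ext; simp
    rw [hs0, hsub, ih (fun i => x i.succ) (fun i => y i.succ) fun i j => h _ _]
    simp only [vandermondeProd, Fin.prod_univ_succ (n := n), Fin.prod_Ioi_zero, Fin.prod_Ioi_succ,
      Finset.prod_div_distrib, Finset.prod_mul_distrib, hB, hA, hc0, Matrix.of_apply]
    have h1 : ∏ i : Fin n, (x i.succ + y 0) ≠ 0 := Finset.prod_ne_zero_iff.2 fun i _ => h _ _
    have h2 : ∏ i : Fin n, (x 0 + y i.succ) ≠ 0 := Finset.prod_ne_zero_iff.2 fun i _ => h _ _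
    have h3 : ∏ i : Fin n, ∏ j : Fin n, (x i.succ + y j.succ) ≠ 0 :=
      Finset.prod_ne_zero_iff.2 fun i _ => Finset.prod_ne_zero_iff.2 fun j _ => h _ _
    have h4 := h 0 0
    simp
    field_simp

/-! ### Measures on the positive orthant. -/

/-- Lebesgue measure on the positive half-line. -/
noncomputable def posVol : Measure ℝ := volume.restrict (Set.Ioi 0)

instance : SigmaFinite posVol := by unfold posVol; infer_instance

/-- The product of `n` copies of Lebesgue measure on the positive half-line. -/
noncomputable def posPi (n : ℕ) : Measure (Fin n → ℝ) := Measure.pi fun _ => posVol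

instance (n : ℕ) : SigmaFinite (posPi n) := by unfold posPi; infer_instance

theorem posPi_eq_restrict (n : ℕ) : posPi n = volume.restrict (orthant n) :=
  (Measure.restrict_pi_pi (fun _ : Fin n => (volume : Measure ℝ)) fun _ => Set.Ioi 0).symm

theorem ae_posVol_pos : ∀ᵐ x ∂posVol, 0 < x := ae_restrict_mem measurableSet_Ioi

theorem ae_posPi_pos (n : ℕ) : ∀ᵐ x ∂posPi n, ∀ i, 0 < x i := by
  rw [posPi_eq_restrict]
  filter_upwards [ae_restrict_mem (MeasurableSet.univ_pi fun _ => measurableSet_Ioi)] with x hx i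
  exact hx i (Set.mem_univ i)

theorem ae_prod_pos (m : Measure ℝ) [SFinite m] (hm : ∀ᵐ x ∂m, 0 < x) :
    ∀ᵐ p ∂m.prod m, 0 < p.1 ∧ 0 < p.2 :=
  (Measure.quasiMeasurePreserving_fst.ae hm).and (Measure.quasiMeasurePreserving_snd.ae hm)

/-- The Schur expansions are available at distinct points; each diagonal `x i = x j` is a proper
subspace, hence null. -/
theorem ae_posPi_injective (n : ℕ) : ∀ᵐ x ∂posPi n, Function.Injective x := by
  rw [posPi_eq_restrict]
  refine ae_restrict_of_ae ?_
  have h : ∀ i j : Fin n, i ≠ j → ∀ᵐ x : Fin n → ℝ, x i ≠ x j := by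
    intro i j hij
    let S : Submodule ℝ (Fin n → ℝ) :=
      LinearMap.ker (LinearMap.proj (R := ℝ) (φ := fun _ : Fin n => ℝ) i - LinearMap.proj j)
    have hS : S ≠ ⊤ := by
      intro h
      have hmem : (Pi.single i 1 : Fin n → ℝ) ∈ S := h ▸ Submodule.mem_top
      simp [S, hij.symm] at hmem
    have h0 := Measure.addHaar_submodule volume S hS
    rw [← compl_mem_ae_iff] at h0
    filter_upwards [h0] with x hx hxij
    exact hx (by simp [S, hxij])
  have h' : ∀ᵐ x : Fin n → ℝ, ∀ i j : Fin n, i ≠ j → x i ≠ x j :=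
    ae_all_iff.2 fun i => ae_all_iff.2 fun j => by
      by_cases hij : i = j
      · simp [hij]
      · filter_upwards [h i j hij] with x hx _ using hx
  filter_upwards [h'] with x hx i j hij
  by_contra hne
  exact hx i j hne hij

/-! ### The Bures form and its Pfaffian expansions. -/

/-- The space of functions integrable on the positive half-line. -/
def integrableFun : Submodule ℂ (ℝ → ℂ) where
  carrier := {f | Integrable f posVol}
  zero_mem' := integrable_zero _ _ _
  add_mem' := fun hf hg => hf.add hg
  smul_mem' := fun c _ hf => hf.smul c

@[fun_prop]
theorem measurable_schurKernel : Measurable fun p : ℝ × ℝ => schurKernel p.1 p.2 := by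
  unfold schurKernel; fun_prop

@[fun_prop]
theorem measurable_schurProd {n : ℕ} : Measurable (schurProd : (Fin n → ℝ) → ℝ) := by
  unfold schurProd schurKernel; fun_prop

theorem integrable_prod_posPi {n : ℕ} (f : Fin n → integrableFun) :
    Integrable (fun x : Fin n → ℝ => ∏ i, (f i).1 (x i)) (posPi n) :=
  Integrable.fintype_prod fun i => (f i).2

theorem integrable_schurProd_mul {n : ℕ} (f : Fin n → integrableFun) :
    Integrable (fun x : Fin n → ℝ => (schurProd x : ℂ) * ∏ i, (f i).1 (x i)) (posPi n) := by
  refine (integrable_prod_posPi f).bdd_mul (c := 1) ?_ ?_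
  · exact (Complex.measurable_ofReal.comp measurable_schurProd).aestronglyMeasurable
  · filter_upwards [ae_posPi_pos n] with x hx
    rw [Complex.norm_real]
    exact abs_schurProd_le hx

theorem integrable_schurKernel_mul (f g : integrableFun) :
    Integrable (fun p : ℝ × ℝ => (schurKernel p.1 p.2 : ℂ) * (f.1 p.1 * g.1 p.2))
      (posVol.prod posVol) := by
  refine (f.2.mul_prod g.2).bdd_mul (c := 1) ?_ ?_
  · exact (Complex.measurable_ofReal.comp measurable_schurKernel).aestronglyMeasurable
  · filter_upwards [ae_prod_pos posVol ae_posVol_pos] with p hp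
    rw [Complex.norm_real]
    exact abs_schurKernel_le hp.1 hp.2

theorem measurePreserving_comp_perm {α : Type*} [MeasurableSpace α] (m : Measure α) [SigmaFinite m]
    {n : ℕ} (σ : Equiv.Perm (Fin n)) :
    MeasurePreserving (MeasurableEquiv.arrowCongr' σ.symm (MeasurableEquiv.refl α))
      (Measure.pi fun _ : Fin n => m) (Measure.pi fun _ : Fin n => m) :=
  measurePreserving_arrowCongr' (fun _ => m) (fun _ => m) σ.symm (MeasurableEquiv.refl α)
    fun _ => MeasurePreserving.id m

theorem integral_posPi_comp_perm {n : ℕ} (σ : Equiv.Perm (Fin n)) (g : (Fin n → ℝ) → ℂ) :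
    ∫ x, g (x ∘ σ) ∂posPi n = ∫ x, g x ∂posPi n :=
  (measurePreserving_comp_perm posVol σ).integral_comp' g

/-- The multilinear form `(f₁, …, fₙ) ↦ ∫ ∏_{i < j} (x_j - x_i) / (x_j + x_i) ∏ f_i(x_i) dx`. -/
noncomputable def buresForm (n : ℕ) : integrableFun [⋀^Fin n]→ₗ[ℂ] ℂ where
  toFun f := ∫ x, (schurProd x : ℂ) * ∏ i, (f i).1 (x i) ∂posPi n
  map_update_add' := by
    intro _ f i a b
    rw [← integral_add (integrable_schurProd_mul _) (integrable_schurProd_mul _)]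
    refine integral_congr_ae (Filter.Eventually.of_forall fun x => ?_)
    -- At fixed `x`, the product of point evaluations is multilinear in `f`.
    let P : MultilinearMap ℂ (fun _ : Fin n => integrableFun) ℂ :=
      (MultilinearMap.mkPiAlgebra ℂ (Fin n) ℂ).compLinearMap
        fun i => (LinearMap.proj (x i)).comp integrableFun.subtype
    have h := P.map_update_add f i a b
    simp only [P, MultilinearMap.compLinearMap_apply, MultilinearMap.mkPiAlgebra_apply,
      LinearMap.comp_apply, LinearMap.proj_apply, Submodule.subtype_apply] at h
    simp only [← mul_add]
    convert congrArg ((schurProd x : ℂ) * ·) h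
  map_update_smul' := by
    intro _ f i c a
    rw [← integral_smul]
    refine integral_congr_ae (Filter.Eventually.of_forall fun x => ?_)
    let P : MultilinearMap ℂ (fun _ : Fin n => integrableFun) ℂ :=
      (MultilinearMap.mkPiAlgebra ℂ (Fin n) ℂ).compLinearMap
        fun i => (LinearMap.proj (x i)).comp integrableFun.subtype
    have h := P.map_update_smul f i c a
    simp only [P, MultilinearMap.compLinearMap_apply, MultilinearMap.mkPiAlgebra_apply,
      LinearMap.comp_apply, LinearMap.proj_apply, Submodule.subtype_apply] at h
    simp only [← mul_smul_comm]
    convert congrArg ((schurProd x : ℂ) * ·) h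
  map_eq_zero_of_eq' := by
    intro f i j hij hne
    -- Swapping two variables attached to equal functions negates the integrand, so `I = -I`.
    set I := ∫ x, (schurProd x : ℂ) * ∏ i, (f i).1 (x i) ∂posPi n with hI
    have h := integral_posPi_comp_perm (Equiv.swap i j)
      fun x => (schurProd x : ℂ) * ∏ i, (f i).1 (x i)
    have h2 : ∀ x : Fin n → ℝ, (schurProd (x ∘ Equiv.swap i j) : ℂ) *
        ∏ k, (f k).1 ((x ∘ Equiv.swap i j) k) = -((schurProd x : ℂ) * ∏ k, (f k).1 (x k)) := by
      intro x
      have hf : ∀ k, f (Equiv.swap i j k) = f k := by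
        intro k
        rcases eq_or_ne k i with rfl | hki
        · rw [Equiv.swap_apply_left, hij]
        · rcases eq_or_ne k j with rfl | hkj
          · rw [Equiv.swap_apply_right, hij]
          · rw [Equiv.swap_apply_of_ne_of_ne hki hkj]
      have hp : ∏ k, (f k).1 ((x ∘ Equiv.swap i j) k) = ∏ k, (f k).1 (x k) := by
        rw [← Equiv.prod_comp (Equiv.swap i j) fun k => (f k).1 (x k)]
        exact Finset.prod_congr rfl fun k _ => by rw [hf]; rfl
      rw [hp, schurProd_comp_perm, Equiv.Perm.sign_swap hne]
      push_cast
      ring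
    simp only [h2, integral_neg, ← hI] at h
    have h3 : (2 : ℂ) * I = 0 := by linear_combination -h
    simpa using h3

theorem buresForm_apply {n : ℕ} (f : Fin n → integrableFun) :
    buresForm n f = ∫ x, (schurProd x : ℂ) * ∏ i, (f i).1 (x i) ∂posPi n := rfl

/-- The bilinear form `(f, g) ↦ ∫∫ (y - x) / (y + x) f(x) g(y) dx dy`. -/
noncomputable def skewForm : integrableFun →ₗ[ℂ] integrableFun →ₗ[ℂ] ℂ :=
  LinearMap.mk₂ ℂ
    (fun f g => ∫ p : ℝ × ℝ, (schurKernel p.1 p.2 : ℂ) * (f.1 p.1 * g.1 p.2) ∂posVol.prod posVol)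
    (fun f f' g => by
      rw [← integral_add (integrable_schurKernel_mul _ _) (integrable_schurKernel_mul _ _)]
      congr 1; ext p
      simp only [Submodule.coe_add, Pi.add_apply]
      ring)
    (fun c f g => by
      rw [← integral_smul]
      congr 1; ext p
      simp only [Submodule.coe_smul, Pi.smul_apply, smul_eq_mul]
      ring)
    (fun f g g' => by
      rw [← integral_add (integrable_schurKernel_mul _ _) (integrable_schurKernel_mul _ _)]
      congr 1; ext p
      simp only [Submodule.coe_add, Pi.add_apply]
      ring)
    (fun c f g => by
      rw [← integral_smul]
      congr 1; ext p
      simp only [Submodule.coe_smul, Pi.smul_apply, smul_eq_mul]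
      ring)

theorem skewForm_apply (f g : integrableFun) : skewForm f g =
    ∫ p : ℝ × ℝ, (schurKernel p.1 p.2 : ℂ) * (f.1 p.1 * g.1 p.2) ∂posVol.prod posVol := rfl

theorem skewForm_isAlt : skewForm.IsAlt := by
  intro f
  have h := integral_prod_swap (μ := posVol) (ν := posVol)
    fun p : ℝ × ℝ => (schurKernel p.1 p.2 : ℂ) * (f.1 p.1 * f.1 p.2)
  have h2 : ∀ p : ℝ × ℝ, (schurKernel p.swap.1 p.swap.2 : ℂ) * (f.1 p.swap.1 * f.1 p.swap.2) =
      -((schurKernel p.1 p.2 : ℂ) * (f.1 p.1 * f.1 p.2)) := by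
    intro p
    rw [Prod.fst_swap, Prod.snd_swap, schurKernel_swap]
    push_cast
    ring
  simp only [h2, integral_neg, ← skewForm_apply] at h
  have h3 : (2 : ℂ) * skewForm f f = 0 := by linear_combination -h
  simpa using h3

/-- The linear form `f ↦ ∫ f(x) dx`. -/
noncomputable def integralForm : integrableFun →ₗ[ℂ] ℂ where
  toFun f := ∫ x, f.1 x ∂posVol
  map_add' f g := integral_add f.2 g.2
  map_smul' c f := integral_smul c f.1

theorem integralForm_apply (f : integrableFun) : integralForm f = ∫ x, f.1 x ∂posVol := rfl

theorem integral_posPi_succAbove {n : ℕ} (j : Fin (n + 1)) (g : ℝ × (Fin n → ℝ) → ℂ) :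
    ∫ x, g (x j, fun i => x (j.succAbove i)) ∂posPi (n + 1) = ∫ p, g p ∂posVol.prod (posPi n) :=
  (measurePreserving_piFinSuccAbove (fun _ : Fin (n + 1) => posVol) j).integral_comp' g

theorem integral_posPi_two_succAbove {n : ℕ} (j : Fin (n + 1)) (g : (ℝ × ℝ) × (Fin n → ℝ) → ℂ) :
    ∫ x, g ((x 0, x j.succ), fun i => x (j.succAbove i).succ) ∂posPi (n + 2) =
      ∫ p, g p ∂(posVol.prod posVol).prod (posPi n) := by
  have h₁ := measurePreserving_piFinSuccAbove (fun _ : Fin (n + 1) => posVol) j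
  have h₂ : MeasurePreserving ((MeasurableEquiv.refl ℝ).prodCongr
      (MeasurableEquiv.piFinSuccAbove (fun _ : Fin (n + 1) => ℝ) j))
      (posVol.prod (posPi (n + 1))) (posVol.prod (posVol.prod (posPi n))) :=
    (MeasurePreserving.id posVol).prod h₁
  have h₃ := (measurePreserving_prodAssoc posVol posVol (posPi n)).symm
  rw [← h₃.integral_comp' g, ← h₂.integral_comp', ← integral_posPi_succAbove 0]
  rfl

theorem buresForm_zero (f : Fin 0 → integrableFun) : buresForm 0 f = 1 := by
  simp [buresForm_apply, schurProd, posPi, Measure.real]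

/-- Integrates `schurProd_even`: each term separates into a function of `(x 0, x j.succ)` and one of
the remaining variables. -/
theorem buresForm_even {n : ℕ} (hn : Even n) (f : Fin (n + 2) → integrableFun) :
    buresForm (n + 2) f = ∑ j : Fin (n + 1), (-1) ^ (j : ℕ) * skewForm (f 0) (f j.succ) *
      buresForm n (fun i => f (j.succAbove i).succ) := by
  have hterm : ∀ j : Fin (n + 1), ∀ x : Fin (n + 2) → ℝ,
      (schurKernel (x 0) (x j.succ) : ℂ) * (schurProd fun i => x (j.succAbove i).succ : ℝ) *
        ∏ i, (f i).1 (x i) =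
      ((schurKernel (x 0) (x j.succ) : ℂ) * ((f 0).1 (x 0) * (f j.succ).1 (x j.succ))) *
        (((schurProd fun i => x (j.succAbove i).succ : ℝ) : ℂ) *
          ∏ i, (f (j.succAbove i).succ).1 (x (j.succAbove i).succ)) := by
    intro j x
    rw [Fin.prod_univ_succ, Fin.prod_univ_succAbove _ j]
    ring
  let g : Fin (n + 1) → (ℝ × ℝ) × (Fin n → ℝ) → ℂ := fun j p =>
    ((schurKernel p.1.1 p.1.2 : ℂ) * ((f 0).1 p.1.1 * (f j.succ).1 p.1.2)) *
      ((schurProd p.2 : ℂ) * ∏ i, (f (j.succAbove i).succ).1 (p.2 i))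
  have hint : ∀ j, Integrable (fun x : Fin (n + 2) → ℝ =>
      g j ((x 0, x j.succ), fun i => x (j.succAbove i).succ)) (posPi (n + 2)) := by
    intro j
    simp only [g, ← hterm]
    refine (integrable_prod_posPi f).bdd_mul (c := 1) ?_ ?_
    · refine Measurable.aestronglyMeasurable ?_
      unfold schurProd schurKernel
      fun_prop
    · filter_upwards [ae_posPi_pos (n + 2)] with x hx
      rw [norm_mul, Complex.norm_real, Complex.norm_real]
      exact mul_le_one₀ (abs_schurKernel_le (hx _) (hx _)) (norm_nonneg _)
        (abs_schurProd_le fun i => hx _)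
  have hsum : buresForm (n + 2) f = ∫ x, ∑ j : Fin (n + 1), (-1) ^ (j : ℕ) *
      g j ((x 0, x j.succ), fun i => x (j.succAbove i).succ) ∂posPi (n + 2) := by
    rw [buresForm_apply]
    refine integral_congr_ae ?_
    filter_upwards [ae_posPi_pos (n + 2), ae_posPi_injective (n + 2)] with x hx hxi
    rw [schurProd_even hn hx hxi]
    push_cast
    rw [Finset.sum_mul]
    refine Finset.sum_congr rfl fun j _ => ?_
    simp only [g]
    rw [← hterm]
    ring
  rw [hsum, integral_finsetSum _ fun j _ => (hint j).const_mul _]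
  refine Finset.sum_congr rfl fun j _ => ?_
  rw [integral_const_mul, integral_posPi_two_succAbove j (g j), mul_assoc]
  congr 1
  exact integral_prod_mul (μ := posVol.prod posVol) (ν := posPi n)
    (fun p : ℝ × ℝ => (schurKernel p.1 p.2 : ℂ) * ((f 0).1 p.1 * (f j.succ).1 p.2))
    fun x => (schurProd x : ℂ) * ∏ i, (f (j.succAbove i).succ).1 (x i)

theorem buresForm_odd {n : ℕ} (hn : Even n) (f : Fin (n + 1) → integrableFun) :
    buresForm (n + 1) f = ∑ j : Fin (n + 1), (-1) ^ (j : ℕ) * integralForm (f j) *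
      buresForm n (fun i => f (j.succAbove i)) := by
  have hterm : ∀ j : Fin (n + 1), ∀ x : Fin (n + 1) → ℝ,
      ((schurProd fun i => x (j.succAbove i) : ℝ) : ℂ) * ∏ i, (f i).1 (x i) =
      (f j).1 (x j) * (((schurProd fun i => x (j.succAbove i) : ℝ) : ℂ) *
          ∏ i, (f (j.succAbove i)).1 (x (j.succAbove i))) := by
    intro j x
    rw [Fin.prod_univ_succAbove _ j]
    ring
  let g : Fin (n + 1) → ℝ × (Fin n → ℝ) → ℂ := fun j p =>
    (f j).1 p.1 * ((schurProd p.2 : ℂ) * ∏ i, (f (j.succAbove i)).1 (p.2 i))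
  have hint : ∀ j, Integrable (fun x : Fin (n + 1) → ℝ =>
      g j (x j, fun i => x (j.succAbove i))) (posPi (n + 1)) := by
    intro j
    simp only [g, ← hterm]
    refine (integrable_prod_posPi f).bdd_mul (c := 1) ?_ ?_
    · refine Measurable.aestronglyMeasurable ?_
      unfold schurProd schurKernel
      fun_prop
    · filter_upwards [ae_posPi_pos (n + 1)] with x hx
      rw [Complex.norm_real]
      exact abs_schurProd_le fun i => hx _
  have hsum : buresForm (n + 1) f = ∫ x, ∑ j : Fin (n + 1), (-1) ^ (j : ℕ) *
      g j (x j, fun i => x (j.succAbove i)) ∂posPi (n + 1) := by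
    rw [buresForm_apply]
    refine integral_congr_ae ?_
    filter_upwards [ae_posPi_pos (n + 1), ae_posPi_injective (n + 1)] with x hx hxi
    rw [schurProd_odd hn hx hxi]
    push_cast
    rw [Finset.sum_mul]
    refine Finset.sum_congr rfl fun j _ => ?_
    simp only [g]
    rw [← hterm, mul_assoc]
  rw [hsum, integral_finsetSum _ fun j _ => (hint j).const_mul _]
  refine Finset.sum_congr rfl fun j _ => ?_
  rw [integral_const_mul, integral_posPi_succAbove j (g j), mul_assoc]
  congr 1
  exact integral_prod_mul (μ := posVol) (ν := posPi n) (f j).1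
    fun x => (schurProd x : ℂ) * ∏ i, (f (j.succAbove i)).1 (x i)

theorem buresForm_sq {n : ℕ} (f : Fin n → integrableFun) :
    buresForm n f ^ 2 = (bilinGram (addRankOne skewForm integralForm) f).det :=
  sq_eq_det_addRankOne skewForm_isAlt integralForm buresForm buresForm_zero
    (fun _ hn => buresForm_even hn) (fun _ hn => buresForm_odd hn) n f

/-! ### The Cauchy pairing and Andréief's identity. -/

/-- The kernel `b / (a + b)`. -/
noncomputable def cauchyKernel (a b : ℝ) : ℝ := b / (a + b)

theorem abs_cauchyKernel_le {a b : ℝ} (ha : 0 < a) (hb : 0 < b) : |cauchyKernel a b| ≤ 1 := by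
  rw [cauchyKernel, abs_of_pos (by positivity), div_le_one (by positivity)]
  linarith

theorem two_mul_cauchyKernel {a b : ℝ} (ha : 0 < a) (hb : 0 < b) :
    2 * cauchyKernel a b = schurKernel a b + 1 := by
  have h : a + b ≠ 0 := by positivity
  rw [cauchyKernel, schurKernel, add_comm b a]
  field_simp
  ring

/-- The pairing `∫∫ y / (x + y) f(x) g(y) dx dy`. -/
noncomputable def cauchyPairing (f g : integrableFun) : ℂ :=
  ∫ p : ℝ × ℝ, (cauchyKernel p.1 p.2 : ℂ) * (f.1 p.1 * g.1 p.2) ∂posVol.prod posVol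

theorem two_mul_cauchyPairing (f g : integrableFun) :
    2 * cauchyPairing f g = addRankOne skewForm integralForm f g := by
  rw [addRankOne_apply, skewForm_apply, integralForm_apply, integralForm_apply,
    ← integral_prod_mul, ← integral_add (integrable_schurKernel_mul f g) (f.2.mul_prod g.2),
    cauchyPairing, ← integral_const_mul]
  refine integral_congr_ae ?_
  filter_upwards [ae_prod_pos posVol ae_posVol_pos] with p hp
  have h := congrArg (fun t : ℝ => (t : ℂ)) (two_mul_cauchyKernel hp.1 hp.2)
  push_cast at h
  rw [← mul_assoc, h]
  ring

/-- Permuting the first block preserves the measure and matches each `y_i` with its partner, so the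
integral factors over pairs. -/
theorem integral_prod_comp_perm {n : ℕ} (σ : Equiv.Perm (Fin n)) (q : Fin n → ℝ × ℝ → ℂ) :
    ∫ p, ∏ i, q i (p.1 (σ i), p.2 i) ∂(posPi n).prod (posPi n) =
      ∏ i, ∫ r, q i r ∂posVol.prod posVol := by
  have h₁ : MeasurePreserving
      ((MeasurableEquiv.arrowCongr' σ.symm (MeasurableEquiv.refl ℝ)).prodCongr
        (MeasurableEquiv.refl (Fin n → ℝ)))
      ((posPi n).prod (posPi n)) ((posPi n).prod (posPi n)) :=
    (measurePreserving_comp_perm posVol σ).prod (MeasurePreserving.id (posPi n))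
  have h₂ : MeasurePreserving (MeasurableEquiv.arrowProdEquivProdArrow ℝ ℝ (Fin n)).symm
      ((posPi n).prod (posPi n)) (Measure.pi fun _ : Fin n => posVol.prod posVol) :=
    (measurePreserving_arrowProdEquivProdArrow ℝ ℝ (Fin n) (fun _ => posVol)
      fun _ => posVol).symm
  rw [← integral_fintype_prod_eq_prod (μ := fun _ => posVol.prod posVol) q, ← h₂.integral_comp']
  exact h₁.integral_comp' fun p =>
    ∏ i, q i ((MeasurableEquiv.arrowProdEquivProdArrow ℝ ℝ (Fin n)).symm p i)

theorem det_cauchyKernel_mul {n : ℕ} (f g : Fin n → integrableFun)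
    (p : (Fin n → ℝ) × (Fin n → ℝ)) :
    ((Matrix.of fun i j => cauchyKernel (p.1 i) (p.2 j)).det : ℂ) *
        ((∏ i, (f i).1 (p.1 i)) * ∏ i, (g i).1 (p.2 i)) =
      ∑ σ : Equiv.Perm (Fin n), ((Equiv.Perm.sign σ : ℤ) : ℂ) *
        ∏ i, ((cauchyKernel (p.1 (σ i)) (p.2 i) : ℂ) *
          ((f (σ i)).1 (p.1 (σ i)) * (g i).1 (p.2 i))) := by
  rw [Matrix.det_apply']
  push_cast
  rw [Finset.sum_mul]
  refine Finset.sum_congr rfl fun σ _ => ?_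
  rw [Finset.prod_mul_distrib, Finset.prod_mul_distrib,
    Equiv.prod_comp σ fun i => (f i).1 (p.1 i), mul_assoc]
  simp

theorem integrable_prod_cauchyKernel {n : ℕ} (f g : Fin n → integrableFun)
    (σ : Equiv.Perm (Fin n)) :
    Integrable (fun p : (Fin n → ℝ) × (Fin n → ℝ) =>
      ∏ i, ((cauchyKernel (p.1 (σ i)) (p.2 i) : ℂ) *
        ((f (σ i)).1 (p.1 (σ i)) * (g i).1 (p.2 i)))) ((posPi n).prod (posPi n)) := by
  have h : ∀ p : (Fin n → ℝ) × (Fin n → ℝ),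
      ∏ i, ((cauchyKernel (p.1 (σ i)) (p.2 i) : ℂ) *
        ((f (σ i)).1 (p.1 (σ i)) * (g i).1 (p.2 i))) =
      (∏ i, (cauchyKernel (p.1 (σ i)) (p.2 i) : ℂ)) *
        ((∏ i, (f i).1 (p.1 i)) * ∏ i, (g i).1 (p.2 i)) := fun p => by
    rw [Finset.prod_mul_distrib, Finset.prod_mul_distrib,
      Equiv.prod_comp σ fun i => (f i).1 (p.1 i)]
  simp only [h]
  refine ((integrable_prod_posPi f).mul_prod (integrable_prod_posPi g)).bdd_mul (c := 1) ?_ ?_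
  · refine Measurable.aestronglyMeasurable ?_
    unfold cauchyKernel
    fun_prop
  · filter_upwards [Measure.quasiMeasurePreserving_fst.ae (ae_posPi_pos n),
      Measure.quasiMeasurePreserving_snd.ae (ae_posPi_pos n)] with p hp₁ hp₂
    rw [norm_prod]
    refine Finset.prod_le_one (fun _ _ => norm_nonneg _) fun i _ => ?_
    rw [Complex.norm_real]
    exact abs_cauchyKernel_le (hp₁ _) (hp₂ _)

theorem integrable_det_cauchyKernel {n : ℕ} (f g : Fin n → integrableFun) :
    Integrable (fun p : (Fin n → ℝ) × (Fin n → ℝ) =>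
      ((Matrix.of fun i j => cauchyKernel (p.1 i) (p.2 j)).det : ℂ) *
        ((∏ i, (f i).1 (p.1 i)) * ∏ i, (g i).1 (p.2 i))) ((posPi n).prod (posPi n)) := by
  simp only [det_cauchyKernel_mul]
  exact integrable_finsetSum _ fun σ _ => (integrable_prod_cauchyKernel f g σ).const_mul _

/-- **Andréief's identity** for the Cauchy kernel. -/
theorem integral_det_cauchyKernel {n : ℕ} (f g : Fin n → integrableFun) :
    ∫ p : (Fin n → ℝ) × (Fin n → ℝ),
      ((Matrix.of fun i j => cauchyKernel (p.1 i) (p.2 j)).det : ℂ) *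
        ((∏ i, (f i).1 (p.1 i)) * ∏ i, (g i).1 (p.2 i)) ∂(posPi n).prod (posPi n) =
      (Matrix.of fun i j => cauchyPairing (f i) (g j)).det := by
  simp only [det_cauchyKernel_mul]
  rw [integral_finsetSum _ fun σ _ => (integrable_prod_cauchyKernel f g σ).const_mul _,
    Matrix.det_apply']
  refine Finset.sum_congr rfl fun σ _ => ?_
  rw [integral_const_mul]
  congr 1
  exact integral_prod_comp_perm σ fun i r =>
    (cauchyKernel r.1 r.2 : ℂ) * ((f (σ i)).1 r.1 * (g i).1 r.2)

/-! ### Integrability of the weights. -/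

/-- Each factor `x ^ θ - lam i` splits into a term with exponent `b + θ` and one with exponent `b`;
hence `b` varies in the induction, which ends at the Gamma integral. -/
theorem integrable_rpow_exp_prod {l : ℕ} {θ : ℝ} (hθ : 0 < θ) (lam : Fin l → ℂ)
    (s : Finset (Fin l)) : ∀ b : ℝ, -1 < b →
    Integrable (fun x : ℝ => ((x ^ b * Real.exp (-x) : ℝ) : ℂ) *
      ∏ i ∈ s, (((x ^ θ : ℝ) : ℂ) - lam i)) posVol := by
  classical
  induction s using Finset.induction_on with
  | empty =>
    intro b hb
    simp only [Finset.prod_empty, mul_one]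
    refine Integrable.ofReal ?_
    have h := Real.GammaIntegral_convergent (s := b + 1) (by linarith)
    rw [add_sub_cancel_right] at h
    exact h.congr (Filter.Eventually.of_forall fun x => mul_comm _ _)
  | insert i s hi ih =>
    intro b hb
    refine ((ih (b + θ) (by linarith)).sub ((ih b hb).const_mul (lam i))).congr ?_
    filter_upwards [ae_posVol_pos] with x hx
    rw [Finset.prod_insert hi, Pi.sub_apply, Real.rpow_add hx]
    push_cast
    ring

/-- The closed half-line lies at positive distance from `z`. -/
theorem exists_norm_inv_sub_le {z : ℂ} (hz : ∀ t : ℝ, 0 ≤ t → z ≠ (t : ℂ)) :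
    ∃ C : ℝ, ∀ x : ℝ, 0 ≤ x → ‖((x : ℂ) - z)⁻¹‖ ≤ C := by
  have hcl : IsClosed ((fun t : ℝ => (t : ℂ)) '' Set.Ici 0) :=
    Complex.isometry_ofReal.isClosedEmbedding.isClosedMap _ isClosed_Ici
  have hmem : z ∉ (fun t : ℝ => (t : ℂ)) '' Set.Ici 0 := by
    rintro ⟨t, ht, rfl⟩
    exact hz t ht rfl
  have hne : ((fun t : ℝ => (t : ℂ)) '' Set.Ici 0).Nonempty := ⟨_, 0, Set.self_mem_Ici, rfl⟩
  have hpos := (hcl.notMem_iff_infDist_pos hne).1 hmem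
  refine ⟨(Metric.infDist z ((fun t : ℝ => (t : ℂ)) '' Set.Ici 0))⁻¹, fun x hx => ?_⟩
  rw [norm_inv]
  refine inv_anti₀ hpos ?_
  rw [← dist_eq_norm, dist_comm]
  exact Metric.infDist_le_dist_of_mem ⟨x, hx, rfl⟩

theorem integrable_charWeight {k l : ℕ} {θ a : ℝ} (hθ : 0 < θ) (ha : -1 < a) {κ : Fin k → ℂ}
    (lam : Fin l → ℂ) (hκ : ∀ i, ∀ t : ℝ, 0 ≤ t → κ i ≠ (t : ℂ)) :
    Integrable (charWeight θ a κ lam) posVol := by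
  choose C hC using fun i => exists_norm_inv_sub_le (hκ i)
  have h := (integrable_rpow_exp_prod hθ lam Finset.univ a ha).bdd_mul (c := ∏ i, C i)
    (f := fun x : ℝ => ∏ i, ((x : ℂ) - κ i)⁻¹) ?_ ?_
  · refine h.congr (Filter.Eventually.of_forall fun x => ?_)
    simp only [charWeight, Finset.prod_inv_distrib]
    ring
  · refine Measurable.aestronglyMeasurable ?_
    fun_prop
  · filter_upwards [ae_posVol_pos] with x hx
    rw [norm_prod]
    exact Finset.prod_le_prod (fun _ _ => norm_nonneg _) fun i _ => hC i x hx.le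

theorem charWeight_add {k l : ℕ} {θ a : ℝ} (b : ℝ) (κ : Fin k → ℂ) (lam : Fin l → ℂ) {x : ℝ}
    (hx : 0 < x) : charWeight θ (a + b) κ lam x = ((x ^ b : ℝ) : ℂ) * charWeight θ a κ lam x := by
  rw [charWeight, charWeight, Real.rpow_add hx]
  push_cast
  ring

/-- The functions `x ↦ (x ^ θ) ^ j` times the weight, as integrable functions. -/
noncomputable def weightedPower {k l : ℕ} {θ a : ℝ} (hθ : 0 < θ) (ha : -1 < a) {κ : Fin k → ℂ}
    (lam : Fin l → ℂ) (hκ : ∀ i, ∀ t : ℝ, 0 ≤ t → κ i ≠ (t : ℂ)) (j : ℕ) : integrableFun :=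
  ⟨fun x => (((x ^ θ) ^ j : ℝ) : ℂ) * charWeight θ a κ lam x, by
    refine (integrable_charWeight (a := a + θ * j) hθ ?_ lam hκ).congr ?_
    · have : 0 ≤ θ * j := by positivity
      linarith
    · filter_upwards [ae_posVol_pos] with x hx
      rw [charWeight_add _ _ _ hx, Real.rpow_mul hx.le, Real.rpow_natCast]⟩

theorem vandermondeProd_eq_sum {n : ℕ} (z : Fin n → ℝ) :
    vandermondeProd z = ∑ σ : Equiv.Perm (Fin n),
      ((Equiv.Perm.sign σ : ℤ) : ℝ) * ∏ i, z i ^ (σ i : ℕ) := by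
  rw [vandermondeProd, ← Matrix.det_vandermonde, ← Matrix.det_transpose, Matrix.det_apply']
  rfl

theorem sign_mul_sign {n : ℕ} (σ : Equiv.Perm (Fin n)) :
    ((Equiv.Perm.sign σ : ℤ) : ℂ) * ((Equiv.Perm.sign σ : ℤ) : ℂ) = 1 := by
  rw [← Int.cast_mul, ← Units.val_mul, Int.units_mul_self]
  simp

/-! ### The two partition functions as a form and a determinant. -/

section Models

variable {N k l : ℕ} {θ a : ℝ} {κ : Fin k → ℂ}

theorem vandermondeProd_mul_charWeight (hθ : 0 < θ) (ha : -1 < a) (lam : Fin l → ℂ)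
    (hκ : ∀ i, ∀ t : ℝ, 0 ≤ t → κ i ≠ (t : ℂ)) (x : Fin N → ℝ) :
    (vandermondeProd (fun i => x i ^ θ) : ℂ) * ∏ j, charWeight θ a κ lam (x j) =
      ∑ σ : Equiv.Perm (Fin N), ((Equiv.Perm.sign σ : ℤ) : ℂ) *
        ∏ i, (weightedPower hθ ha lam hκ (σ i)).1 (x i) := by
  rw [vandermondeProd_eq_sum]
  push_cast
  rw [Finset.sum_mul]
  refine Finset.sum_congr rfl fun σ _ => ?_
  simp only [weightedPower, Finset.prod_mul_distrib]
  push_cast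
  ring

theorem buresIntegrand_eq_sum (hθ : 0 < θ) (ha : -1 < a) (lam : Fin l → ℂ)
    (hκ : ∀ i, ∀ t : ℝ, 0 ≤ t → κ i ≠ (t : ℂ)) (x : Fin N → ℝ) :
    buresIntegrand θ a κ lam x = ∑ σ : Equiv.Perm (Fin N), ((Equiv.Perm.sign σ : ℤ) : ℂ) *
      ((schurProd x : ℂ) * ∏ i, (weightedPower hθ ha lam hκ (σ i)).1 (x i)) := by
  have h := vandermondeProd_mul_charWeight hθ ha lam hκ x
  have h2 : (∏ i, ∏ j ∈ Finset.Ioi i, ((x j - x i) / (x j + x i) * (x j ^ θ - x i ^ θ))) =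
      schurProd x * vandermondeProd (fun i => x i ^ θ) := by
    simp only [schurProd, schurKernel, vandermondeProd, ← Finset.prod_mul_distrib]
  rw [buresIntegrand, h2]
  push_cast
  rw [mul_assoc, h, Finset.mul_sum]
  exact Finset.sum_congr rfl fun σ _ => by ring

theorem integrable_buresIntegrand (hθ : 0 < θ) (ha : -1 < a) (lam : Fin l → ℂ)
    (hκ : ∀ i, ∀ t : ℝ, 0 ≤ t → κ i ≠ (t : ℂ)) :
    Integrable (buresIntegrand (N := N) θ a κ lam) (posPi N) := by
  simp only [funext (buresIntegrand_eq_sum (N := N) hθ ha lam hκ)]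
  exact integrable_finsetSum _ fun σ _ => (integrable_schurProd_mul _).const_mul _

/-- Alternation makes all `N!` terms of the Vandermonde expansion equal, the sign occurring twice.
-/
theorem buresZ_eq_buresForm (hθ : 0 < θ) (ha : -1 < a) (lam : Fin l → ℂ)
    (hκ : ∀ i, ∀ t : ℝ, 0 ≤ t → κ i ≠ (t : ℂ)) :
    buresZ N θ a κ lam = buresForm N fun i => weightedPower hθ ha lam hκ i := by
  have hperm : ∀ σ : Equiv.Perm (Fin N), ∫ x, ((Equiv.Perm.sign σ : ℤ) : ℂ) *
      ((schurProd x : ℂ) * ∏ i, (weightedPower hθ ha lam hκ (σ i)).1 (x i)) ∂posPi N =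
      buresForm N fun i => weightedPower hθ ha lam hκ i := by
    intro σ
    have h := (buresForm N).map_perm (fun i => weightedPower hθ ha lam hκ i) σ
    rw [buresForm_apply] at h
    rw [integral_const_mul]
    refine (congrArg _ h).trans ?_
    rw [Units.smul_def, zsmul_eq_mul, ← mul_assoc, sign_mul_sign, one_mul]
  rw [buresZ, ← posPi_eq_restrict]
  simp only [buresIntegrand_eq_sum hθ ha lam hκ]
  rw [integral_finsetSum _ fun σ _ => (integrable_schurProd_mul _).const_mul _,
    Finset.sum_congr rfl fun σ _ => hperm σ, Finset.sum_const, Finset.card_univ,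
    Fintype.card_perm, Fintype.card_fin, nsmul_eq_mul, ← mul_assoc, one_div,
    inv_mul_cancel₀ (Nat.cast_ne_zero.2 N.factorial_ne_zero), one_mul]

theorem det_cauchyKernel (x y : Fin N → ℝ) (hx : ∀ i, 0 < x i) (hy : ∀ i, 0 < y i) :
    (Matrix.of fun i j => cauchyKernel (x i) (y j)).det =
      (∏ j, y j) * (vandermondeProd x * vandermondeProd y / ∏ i, ∏ j, (x i + y j)) := by
  rw [← det_cauchy x y fun i j => (add_pos (hx i) (hy j)).ne', ← Matrix.det_mul_row]
  rfl

/-- The choice `b = a + 1` supplies `∏ y_j`, which turns the kernel `1 / (x + y)` into the bounded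
`y / (x + y)` and leaves the same weight in both blocks. -/
theorem cauchyIntegrand_ae_eq (hθ : 0 < θ) (ha : -1 < a) (lam : Fin l → ℂ)
    (hκ : ∀ i, ∀ t : ℝ, 0 ≤ t → κ i ≠ (t : ℂ)) :
    cauchyIntegrand (N := N) θ a (a + 1) κ lam κ lam =ᵐ[(posPi N).prod (posPi N)] fun p =>
      ∑ σ : Equiv.Perm (Fin N), ∑ τ : Equiv.Perm (Fin N),
        ((Equiv.Perm.sign σ : ℤ) : ℂ) * ((Equiv.Perm.sign τ : ℤ) : ℂ) *
        (((Matrix.of fun i j => cauchyKernel (p.1 i) (p.2 j)).det : ℂ) *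
          ((∏ i, (weightedPower hθ ha lam hκ (σ i)).1 (p.1 i)) *
            ∏ i, (weightedPower hθ ha lam hκ (τ i)).1 (p.2 i))) := by
  filter_upwards [Measure.quasiMeasurePreserving_fst.ae (ae_posPi_pos N),
    Measure.quasiMeasurePreserving_snd.ae (ae_posPi_pos N)] with p hp₁ hp₂
  have h₁ := vandermondeProd_mul_charWeight hθ ha lam hκ p.1
  have h₂ := vandermondeProd_mul_charWeight hθ ha lam hκ p.2
  have hw : ∀ j, charWeight θ (a + 1) κ lam (p.2 j) = (p.2 j : ℂ) * charWeight θ a κ lam (p.2 j) :=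
    fun j => by rw [charWeight_add _ _ _ (hp₂ j), Real.rpow_one]
  have hL : cauchyIntegrand θ a (a + 1) κ lam κ lam p =
      ((Matrix.of fun i j => cauchyKernel (p.1 i) (p.2 j)).det : ℂ) *
      (((vandermondeProd (fun i => p.1 i ^ θ) : ℂ) * ∏ j, charWeight θ a κ lam (p.1 j)) *
      ((vandermondeProd (fun i => p.2 i ^ θ) : ℂ) * ∏ j, charWeight θ a κ lam (p.2 j))) := by
    rw [det_cauchyKernel _ _ hp₁ hp₂, cauchyIntegrand]
    simp only [hw, Finset.prod_mul_distrib]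
    push_cast
    ring
  rw [hL, h₁, h₂, Finset.sum_mul_sum, Finset.mul_sum]
  refine Finset.sum_congr rfl fun σ _ => ?_
  rw [Finset.mul_sum]
  exact Finset.sum_congr rfl fun τ _ => by ring

theorem integrable_cauchyIntegrand (hθ : 0 < θ) (ha : -1 < a) (lam : Fin l → ℂ)
    (hκ : ∀ i, ∀ t : ℝ, 0 ≤ t → κ i ≠ (t : ℂ)) :
    Integrable (cauchyIntegrand (N := N) θ a (a + 1) κ lam κ lam) ((posPi N).prod (posPi N)) := by
  refine Integrable.congr ?_ (cauchyIntegrand_ae_eq hθ ha lam hκ).symm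
  exact integrable_finsetSum _ fun σ _ => integrable_finsetSum _ fun τ _ =>
    (integrable_det_cauchyKernel (fun i => weightedPower hθ ha lam hκ (σ i))
      fun i => weightedPower hθ ha lam hκ (τ i)).const_mul _

theorem cauchyZ_eq_det (hθ : 0 < θ) (ha : -1 < a) (lam : Fin l → ℂ)
    (hκ : ∀ i, ∀ t : ℝ, 0 ≤ t → κ i ≠ (t : ℂ)) :
    cauchyZ N θ a (a + 1) κ lam κ lam = (Matrix.of fun i j : Fin N =>
      cauchyPairing (weightedPower hθ ha lam hκ i) (weightedPower hθ ha lam hκ j)).det := by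
  set M : Matrix (Fin N) (Fin N) ℂ := Matrix.of fun i j =>
    cauchyPairing (weightedPower hθ ha lam hκ i) (weightedPower hθ ha lam hκ j)
  have hint : ∀ σ τ : Equiv.Perm (Fin N), _ := fun σ τ =>
    (integrable_det_cauchyKernel (fun i => weightedPower hθ ha lam hκ (σ i))
      fun i => weightedPower hθ ha lam hκ (τ i)).const_mul
        (((Equiv.Perm.sign σ : ℤ) : ℂ) * ((Equiv.Perm.sign τ : ℤ) : ℂ))
  have hperm : ∀ σ τ : Equiv.Perm (Fin N),
      ∫ p : (Fin N → ℝ) × (Fin N → ℝ),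
        ((Equiv.Perm.sign σ : ℤ) : ℂ) * ((Equiv.Perm.sign τ : ℤ) : ℂ) *
        (((Matrix.of fun i j => cauchyKernel (p.1 i) (p.2 j)).det : ℂ) *
          ((∏ i, (weightedPower hθ ha lam hκ (σ i)).1 (p.1 i)) *
            ∏ i, (weightedPower hθ ha lam hκ (τ i)).1 (p.2 i))) ∂(posPi N).prod (posPi N) =
      M.det := by
    intro σ τ
    rw [integral_const_mul, integral_det_cauchyKernel
      (fun i => weightedPower hθ ha lam hκ (σ i)) fun i => weightedPower hθ ha lam hκ (τ i)]
    have hM : (Matrix.of fun i j : Fin N => cauchyPairing (weightedPower hθ ha lam hκ (σ i))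
        (weightedPower hθ ha lam hκ (τ j))) = (M.submatrix σ id).submatrix id τ := rfl
    -- Permuting rows by `σ` and columns by `τ` yields both signs again, so each of the `(N!) ^ 2`
    -- terms equals `M.det`.
    rw [hM, Matrix.det_permute', Matrix.det_permute]
    linear_combination (M.det * ((Equiv.Perm.sign τ : ℤ) : ℂ) * ((Equiv.Perm.sign τ : ℤ) : ℂ)) *
      sign_mul_sign σ + M.det * sign_mul_sign τ
  rw [cauchyZ, Measure.volume_eq_prod, ← Measure.prod_restrict, ← posPi_eq_restrict,
    integral_congr_ae (cauchyIntegrand_ae_eq hθ ha lam hκ),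
    integral_finsetSum _ fun σ _ => integrable_finsetSum _ fun τ _ => hint σ τ,
    Finset.sum_congr rfl fun σ _ => (integral_finsetSum _ fun τ _ => hint σ τ).trans
      (Finset.sum_congr rfl fun τ _ => hperm σ τ)]
  have hfac : (N.factorial : ℂ) ≠ 0 := Nat.cast_ne_zero.2 N.factorial_ne_zero
  simp only [Finset.sum_const, Finset.card_univ, Fintype.card_perm, Fintype.card_fin, nsmul_eq_mul]
  field_simp

end Models

end ThetaBures

theorem mainTheorem12 (N k l : ℕ) (θ a : ℝ) (hθ : 0 < θ) (ha : -1 < a)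
    (κ : Fin k → ℂ) (lam : Fin l → ℂ) (hκ : ∀ i, ∀ t : ℝ, 0 ≤ t → κ i ≠ (t : ℂ)) :
    MeasureTheory.IntegrableOn
      (ThetaBures.buresIntegrand (N := N) θ a κ lam) (ThetaBures.orthant N) ∧
    MeasureTheory.IntegrableOn
      (ThetaBures.cauchyIntegrand (N := N) θ a (a + 1) κ lam κ lam)
      (ThetaBures.orthant N ×ˢ ThetaBures.orthant N) ∧
    (ThetaBures.buresZ N θ a κ lam) ^ 2 =
      2 ^ N * ThetaBures.cauchyZ N θ a (a + 1) κ lam κ lam := by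
  refine ⟨?_, ?_, ?_⟩
  · rw [IntegrableOn, ← ThetaBures.posPi_eq_restrict]
    exact ThetaBures.integrable_buresIntegrand hθ ha lam hκ
  · rw [IntegrableOn, Measure.volume_eq_prod, ← Measure.prod_restrict,
      ← ThetaBures.posPi_eq_restrict]
    exact ThetaBures.integrable_cauchyIntegrand hθ ha lam hκ
  · rw [ThetaBures.buresZ_eq_buresForm hθ ha lam hκ, ThetaBures.cauchyZ_eq_det hθ ha lam hκ,
      ThetaBures.buresForm_sq]
    -- The factor `2 ^ N` is the homogeneity of an `N × N` determinant under scaling by 2.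
    have h := Matrix.det_smul (Matrix.of fun i j : Fin N => ThetaBures.cauchyPairing
      (ThetaBures.weightedPower hθ ha lam hκ i) (ThetaBures.weightedPower hθ ha lam hκ j)) 2
    rw [Fintype.card_fin] at h
    rw [← h]
    congr 1
    ext i j
    exact (ThetaBures.two_mul_cauchyPairing _ _).symm
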